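/- There are absolute constants $c_0, c > 0$ such that the following holds. Let $L > 0$, $\Delta > 0$, let $n \ge 1$ be an integer, and let $\varepsilon > 0$ satisfy $\varepsilon^2 \le c_0 L\Delta$. Then there are a dimension $d$ and a finite-sum problem $\min_{x\in\mathbb{R}^d} f(x)$, $f = \frac1n\sum_{i=1}^n f_i$, such that every $f_i:\mathbb{R}^d\to\mathbb{R}$ is $L$-smooth (differentiable with $\|\nabla f_i(x)-\nabla f_i(y)\|\le L\|x-y\|$ for all $x,y$), $f$ is bounded below with $f(0)-\inf_x f(x)=\Delta$, and any (possibly randomized) first-order method with shuffled component access started at $0$ whose output $\hat x$ satisfies $\mathbb{E}\|\nabla f(\hat x)\|^2\le\varepsilon^2$ makes at least $$N_c \;\ge\; c\,\frac{L\Delta}{\varepsilon^2}$$ oracle calls; that is, $N_c=\Omega(L\Delta/\varepsilon^2)$. Here an oracle call returns $\nabla f_i(x)$ for one component $i$ and one point $x$. Shuffled component access means that the iterations are grouped into epochs of $n$ iterations, that in each epoch the component used in the successive iterations runs through a permutation of $\{1,\dots,n\}$ (chosen in any way, random or not, e.g. reshuffled in every epoch, shuffled once, or cyclic), and that the method calls,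 in each iteration, only that component, at one or more points, every call being counted. A first-order method is one that explores the space only through the gradients it has received: a coordinate of a query point or of the output $\hat x$ can be nonzero only if it is nonzero in some gradient returned by an earlier oracle call (this includes all methods whose iterates are linear combinations of $0$ and the gradients received so far). -/

import Mathlib

/-- The objective `f = (1/n) ∑ i, f_i` of a finite-sum problem on `ℝ^d` (Euclidean norm). -/
noncomputable def finiteSum {n d : ℕ} (f : Fin n → EuclideanSpace ℝ (Fin d) → ℝ) :
    EuclideanSpace ℝ (Fin d) → ℝ :=
  fun x => (1 / (n : ℝ)) * ∑ i, f i x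

/-- `g` is `L`-smooth: it is differentiable and its gradient is `L`-Lipschitz. -/
def IsLSmooth {d : ℕ} (L : ℝ) (g : EuclideanSpace ℝ (Fin d) → ℝ) : Prop :=
  Differentiable ℝ g ∧ ∀ x y, ‖gradient g x - gradient g y‖ ≤ L * ‖x - y‖

/-- The set of nonzero coordinates of a vector. -/
def coordSupport {d : ℕ} (v : EuclideanSpace ℝ (Fin d)) : Set (Fin d) :=
  {j | v j ≠ 0}

/-- The component that a shuffling scheme visits at iteration `t` (counted over all epochs):
epoch `t / n` runs through the components in the order `π (t / n)`, so that every component is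
visited exactly once per epoch. -/
def shuffledComponent {n : ℕ} [NeZero n] (π : ℕ → Equiv.Perm (Fin n)) (t : ℕ) : Fin n :=
  π (t / n) (Fin.ofNat n t)

/-- A (randomized) first-order method with shuffled component access, started at the origin, run on
the components `f` with a total of `T` calls of the component gradient oracle. `Ω` carries all the
randomness, of the shuffling and of the method itself. No law of the permutations is prescribed:
fresh random permutations in each epoch, one random permutation used in all epochs, and a fixed
cyclic order are all allowed.

The `k`-th oracle call (`k < T`) takes place during iteration `iter k`, concerns the component that
the shuffling scheme visits in that iteration, and returns its gradient at the point `query k`.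
A method may call its current component at several points before moving on (as the shuffled
variants of SVRG and SARAH do), and each of these calls is counted.

First-order methods explore the space through the gradients they have received only: a coordinate
of a query point, or of the output, can be nonzero only if it was nonzero in one of the gradients
returned before. This includes every method whose iterates are linear combinations of the gradients
returned so far. In particular the first query point is the origin. -/
structure ShuffledFirstOrderRun {n d : ℕ} [NeZero n]
    (f : Fin n → EuclideanSpace ℝ (Fin d) → ℝ) (T : ℕ) (Ω : Type*) [MeasurableSpace Ω] where
  /-- the permutation used in each epoch -/
  perm : Ω → ℕ → Equiv.Perm (Fin n)
  /-- the iteration to which an oracle call belongs -/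
  iter : Ω → ℕ → ℕ
  /-- the point at which an oracle call is made -/
  query : Ω → ℕ → EuclideanSpace ℝ (Fin d)
  /-- the point returned after `T` oracle calls -/
  output : Ω → EuclideanSpace ℝ (Fin d)
  iter_zero : ∀ ω, iter ω 0 = 0
  iter_succ : ∀ ω k, iter ω (k + 1) = iter ω k ∨ iter ω (k + 1) = iter ω k + 1
  query_support : ∀ ω, ∀ k < T, coordSupport (query ω k) ⊆
    ⋃ l < k, coordSupport (gradient (f (shuffledComponent (perm ω) (iter ω l))) (query ω l))
  output_support : ∀ ω, coordSupport (output ω) ⊆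
    ⋃ l < T, coordSupport (gradient (f (shuffledComponent (perm ω) (iter ω l))) (query ω l))
  measurable_output : Measurable output

/-- The run reaches `ε`-accuracy on the objective: `𝔼 ‖∇f(output)‖² ≤ ε²`. -/
def ShuffledFirstOrderRun.ReachesAccuracy {n d : ℕ} [NeZero n]
    {f : Fin n → EuclideanSpace ℝ (Fin d) → ℝ} {T : ℕ} {Ω : Type*} [MeasurableSpace Ω]
    (A : ShuffledFirstOrderRun f T Ω) (P : MeasureTheory.Measure Ω) (ε : ℝ) : Prop :=
  ∫⁻ ω, ENNReal.ofReal (‖gradient (finiteSum f) (A.output ω)‖ ^ 2) ∂P ≤ ENNReal.ofReal (ε ^ 2)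

/-! All components are the same function, so the order of visits is irrelevant and `n` does not
enter the bound. That function is a rescaled chain: neighbours attract each other through products,
the left end is pinned to 1, and a potential vanishing on [0, 1] confines each coordinate. A
gradient reveals at most one new coordinate (`coordSupport_chainGradient_subset`), while a vanishing
coordinate keeps the gradient norm at least 1/4 (`one_fourth_le_norm_chainGradient`). The depth of
the chain is at most 4d (`neg_four_mul_le_chainFunction`), so rescaling to gap Δ and smoothness L
leaves a squared gradient of order LΔ/d until d calls are made. Taking d of order LΔ/ε² gives the
bound. -/

/-- The positive part of a real number, squared, is differentiable. -/
theorem hasDerivAt_posPart_sq (t : ℝ) :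
    HasDerivAt (fun s : ℝ => max s 0 ^ 2) (2 * max t 0) t := by
  rw [hasDerivAt_iff_isLittleO]
  -- The derivative is 2-Lipschitz, so the Taylor remainder lies between 0 and (s - t)².
  have h : (fun s : ℝ => max s 0 ^ 2 - max t 0 ^ 2 - (s - t) • (2 * max t 0)) =O[nhds t]
      fun s => (s - t) ^ 2 := by
    refine Asymptotics.IsBigO.of_bound 1 (Filter.Eventually.of_forall fun s => ?_)
    rw [Real.norm_eq_abs, Real.norm_eq_abs, abs_of_nonneg (sq_nonneg (s - t)), abs_le, smul_eq_mul]
    constructor <;> rcases max_cases s 0 with ⟨h, h'⟩ | ⟨h, h'⟩ <;>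
      rcases max_cases t 0 with ⟨k, k'⟩ | ⟨k, k'⟩ <;> rw [h, k] <;> nlinarith
  exact h.trans_isLittleO (by simpa using Asymptotics.isLittleO_pow_sub_sub t one_lt_two)

/-- The potential acting on each coordinate of the chain: three halves of the squared distance to
`[0, 1]`. -/
noncomputable def chainPotential (t : ℝ) : ℝ :=
  3 / 2 * (max (t - 1) 0 ^ 2 + max (-t) 0 ^ 2)

/-- The derivative of `chainPotential`. -/
noncomputable def chainForce (t : ℝ) : ℝ :=
  3 * (max (t - 1) 0 - max (-t) 0)

theorem hasDerivAt_chainPotential (t : ℝ) :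
    HasDerivAt chainPotential (chainForce t) t := by
  have h₁ := (hasDerivAt_posPart_sq (t - 1)).comp t ((hasDerivAt_id t).sub_const 1)
  have h₂ := (hasDerivAt_posPart_sq (-t)).comp t (hasDerivAt_neg t)
  refine ((h₁.add h₂).const_mul (3 / 2)).congr_deriv ?_
  unfold chainForce
  ring

theorem abs_chainForce_sub_le (s t : ℝ) : |chainForce s - chainForce t| ≤ 3 * |s - t| := by
  unfold chainForce
  rcases abs_cases (s - t) with ⟨h, _⟩ | ⟨h, _⟩ <;> rw [h, abs_le] <;> constructor <;>
    rcases max_cases (s - 1) 0 with ⟨h₁, _⟩ | ⟨h₁, _⟩ <;>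
    rcases max_cases (-s) 0 with ⟨h₂, _⟩ | ⟨h₂, _⟩ <;>
    rcases max_cases (t - 1) 0 with ⟨h₃, _⟩ | ⟨h₃, _⟩ <;>
    rcases max_cases (-t) 0 with ⟨h₄, _⟩ | ⟨h₄, _⟩ <;> rw [h₁, h₂, h₃, h₄] <;> linarith

theorem chainForce_zero : chainForce 0 = 0 := by norm_num [chainForce]

theorem chainPotential_zero : chainPotential 0 = 0 := by norm_num [chainPotential]

theorem chainForce_of_nonpos {t : ℝ} (ht : t ≤ 0) : chainForce t = 3 * t := by
  rw [chainForce, max_eq_right (by linarith), max_eq_left (by linarith)]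
  ring

theorem chainForce_nonpos_of_le_one {t : ℝ} (ht : t ≤ 1) : chainForce t ≤ 0 := by
  rw [chainForce, max_eq_right (by linarith)]
  linarith [le_max_right (-t) 0]

/-- The constant 3 is sharp: on t ≥ 1 the difference of the two sides is (t - 3)² / 2. -/
theorem sq_sub_three_le_chainPotential (t : ℝ) : t ^ 2 - 3 ≤ chainPotential t := by
  unfold chainPotential
  rcases max_cases (t - 1) 0 with ⟨h₁, _⟩ | ⟨h₁, _⟩ <;>
    rcases max_cases (-t) 0 with ⟨h₂, _⟩ | ⟨h₂, _⟩ <;> rw [h₁, h₂] <;>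
    nlinarith [sq_nonneg (t - 3)]

/-! ### The chain function and its gradient -/

/-- The coordinates of a vector listed as a sequence that starts at index `1` and is padded with
zeros at index `0` and beyond the dimension. -/
noncomputable def paddedCoord (d : ℕ) : ℕ → EuclideanSpace ℝ (Fin d) →L[ℝ] ℝ
  | 0 => 0
  | k + 1 => if h : k < d then EuclideanSpace.proj ⟨k, h⟩ else 0

/-- The padded sequence of coordinates, with the value `1` at index `0`. -/
noncomputable def chainCoord (d k : ℕ) (x : EuclideanSpace ℝ (Fin d)) : ℝ :=
  (if k = 0 then 1 else 0) + paddedCoord d k x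

section Chain

variable {d : ℕ}

theorem paddedCoord_zero : paddedCoord d 0 = 0 := rfl

theorem paddedCoord_succ_of_lt {k : ℕ} (h : k < d) (x : EuclideanSpace ℝ (Fin d)) :
    paddedCoord d (k + 1) x = x ⟨k, h⟩ := by
  simp [paddedCoord, h]

theorem paddedCoord_succ_of_le {k : ℕ} (h : d ≤ k) : paddedCoord d (k + 1) = 0 := by
  simp [paddedCoord, h]

theorem paddedCoord_succ_val (j : Fin d) (x : EuclideanSpace ℝ (Fin d)) :
    paddedCoord d (j + 1) x = x j :=
  paddedCoord_succ_of_lt j.2 x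

theorem chainCoord_zero (x : EuclideanSpace ℝ (Fin d)) : chainCoord d 0 x = 1 := by
  simp [chainCoord, paddedCoord_zero]

theorem chainCoord_succ (k : ℕ) (x : EuclideanSpace ℝ (Fin d)) :
    chainCoord d (k + 1) x = paddedCoord d (k + 1) x := by
  simp [chainCoord]

theorem chainCoord_sub (k : ℕ) (x y : EuclideanSpace ℝ (Fin d)) :
    chainCoord d k x - chainCoord d k y = paddedCoord d k (x - y) := by
  simp [chainCoord]

theorem hasFDerivAt_chainCoord (k : ℕ) (x : EuclideanSpace ℝ (Fin d)) :
    HasFDerivAt (chainCoord d k) (paddedCoord d k) x :=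
  (paddedCoord d k).hasFDerivAt.const_add _

/-- The hard instance: a chain of coordinates, started at the value `1`, in which neighbours
attract each other. -/
noncomputable def chainFunction (d : ℕ) (x : EuclideanSpace ℝ (Fin d)) : ℝ :=
  ∑ k ∈ Finset.range d, (chainPotential (paddedCoord d (k + 1) x) -
    chainCoord d k x * chainCoord d (k + 1) x)

/-- The gradient of `chainFunction`. -/
noncomputable def chainGradient (d : ℕ) (x : EuclideanSpace ℝ (Fin d)) :
    EuclideanSpace ℝ (Fin d) :=
  WithLp.toLp 2 fun j => chainForce (x j) - chainCoord d j x - chainCoord d (j + 2) x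

theorem chainGradient_apply (x : EuclideanSpace ℝ (Fin d)) (j : Fin d) :
    chainGradient d x j = chainForce (x j) - chainCoord d j x - chainCoord d (j + 2) x := rfl

/-- Reindexing by one: the boundary terms vanish at index 0 and past the dimension. It gathers the
contributions of both neighbours at each coordinate of the gradient. -/
theorem sum_range_paddedCoord_shift (x h : EuclideanSpace ℝ (Fin d)) :
    ∑ k ∈ Finset.range d, chainCoord d (k + 1) x * paddedCoord d k h =
      ∑ k ∈ Finset.range d, chainCoord d (k + 2) x * paddedCoord d (k + 1) h := by
  have h₁ := Finset.sum_range_succ (fun k => chainCoord d (k + 1) x * paddedCoord d k h) d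
  have h₂ := Finset.sum_range_succ' (fun k => chainCoord d (k + 1) x * paddedCoord d k h) d
  have h₃ : chainCoord d (d + 1) x = 0 := by
    rw [chainCoord_succ, paddedCoord_succ_of_le le_rfl]
    rfl
  rw [h₃] at h₁
  simp only [paddedCoord_zero, zero_apply, mul_zero, add_zero, zero_mul]
    at h₁ h₂
  exact h₁.symm.trans h₂

theorem hasGradientAt_chainFunction (x : EuclideanSpace ℝ (Fin d)) :
    HasGradientAt (chainFunction d) (chainGradient d x) x := by
  rw [hasGradientAt_iff_hasFDerivAt]
  have hterm : ∀ k ∈ Finset.range d, HasFDerivAt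
      (fun x => chainPotential (paddedCoord d (k + 1) x) -
        chainCoord d k x * chainCoord d (k + 1) x)
      (chainForce (paddedCoord d (k + 1) x) • paddedCoord d (k + 1) -
        (chainCoord d k x • paddedCoord d (k + 1) + chainCoord d (k + 1) x • paddedCoord d k)) x :=
    fun k _ => ((hasDerivAt_chainPotential _).comp_hasFDerivAt x
      (paddedCoord d (k + 1)).hasFDerivAt).sub
        ((hasFDerivAt_chainCoord k x).mul (hasFDerivAt_chainCoord (k + 1) x))
  refine (HasFDerivAt.fun_sum hterm).congr_fderiv ?_
  ext h
  have hinner : inner ℝ (chainGradient d x) h = ∑ k ∈ Finset.range d,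
      (chainForce (paddedCoord d (k + 1) x) - chainCoord d k x - chainCoord d (k + 2) x) *
        paddedCoord d (k + 1) h := by
    rw [PiLp.inner_apply, Finset.sum_range]
    refine Finset.sum_congr rfl fun j _ => ?_
    rw [chainGradient_apply, paddedCoord_succ_val, paddedCoord_succ_val]
    simp [mul_comm]
  rw [InnerProductSpace.toDual_apply_apply, hinner]
  simp only [sum_apply, sub_apply,
    add_apply, smul_apply, smul_eq_mul, sub_mul,
    Finset.sum_sub_distrib, Finset.sum_add_distrib, sum_range_paddedCoord_shift]
  ring

theorem sum_range_paddedCoord_succ_sq (z : EuclideanSpace ℝ (Fin d)) :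
    ∑ k ∈ Finset.range d, paddedCoord d (k + 1) z ^ 2 = ‖z‖ ^ 2 := by
  rw [EuclideanSpace.real_norm_sq_eq, Finset.sum_range]
  exact Finset.sum_congr rfl fun j _ => by rw [paddedCoord_succ_val]

theorem sum_range_paddedCoord_sq_le (z : EuclideanSpace ℝ (Fin d)) :
    ∑ k ∈ Finset.range d, paddedCoord d k z ^ 2 ≤ ‖z‖ ^ 2 := by
  have h := Finset.sum_range_succ' (fun k => paddedCoord d k z ^ 2) d
  rw [Finset.sum_range_succ, sum_range_paddedCoord_succ_sq] at h
  simp only [paddedCoord_zero, zero_apply] at h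
  nlinarith [sq_nonneg (paddedCoord d d z)]

theorem sum_range_paddedCoord_add_two_sq_le (z : EuclideanSpace ℝ (Fin d)) :
    ∑ k ∈ Finset.range d, paddedCoord d (k + 2) z ^ 2 ≤ ‖z‖ ^ 2 := by
  have h := Finset.sum_range_succ' (fun k => paddedCoord d (k + 1) z ^ 2) d
  rw [Finset.sum_range_succ, sum_range_paddedCoord_succ_sq, paddedCoord_succ_of_le le_rfl] at h
  simp only [zero_apply] at h
  nlinarith [sq_nonneg (paddedCoord d (0 + 1) z)]

theorem norm_chainGradient_sub_le (x y : EuclideanSpace ℝ (Fin d)) :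
    ‖chainGradient d x - chainGradient d y‖ ≤ 6 * ‖x - y‖ := by
  refine (sq_le_sq₀ (norm_nonneg _) (by positivity)).mp ?_
  set z := x - y with hz
  -- By (p - u - v)² ≤ 3(p² + u² + v²), the sum over all coordinates is at most 3(9 + 1 + 1) = 33 ≤
  -- 6² times ‖z‖².
  have hcoord : ∀ j : Fin d, (chainGradient d x - chainGradient d y) j ^ 2 ≤
      3 * (9 * paddedCoord d (j + 1) z ^ 2 + paddedCoord d j z ^ 2 +
        paddedCoord d (j + 2) z ^ 2) := by
    intro j
    have hforce : (chainForce (x j) - chainForce (y j)) ^ 2 ≤ 9 * paddedCoord d (j + 1) z ^ 2 := by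
      have h := abs_chainForce_sub_le (x j) (y j)
      have h' : paddedCoord d (j + 1) z = x j - y j := paddedCoord_succ_val j z
      rw [h', ← sq_abs, ← sq_abs (x j - y j)]
      nlinarith [abs_nonneg (chainForce (x j) - chainForce (y j)), abs_nonneg (x j - y j)]
    have heq : (chainGradient d x - chainGradient d y) j =
        (chainForce (x j) - chainForce (y j)) - paddedCoord d j z - paddedCoord d (j + 2) z := by
      rw [PiLp.sub_apply, chainGradient_apply, chainGradient_apply, hz, ← chainCoord_sub,
        ← chainCoord_sub]
      ring
    rw [heq]
    set p := chainForce (x j) - chainForce (y j)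
    nlinarith [sq_nonneg (p + paddedCoord d j z), sq_nonneg (p + paddedCoord d (j + 2) z),
      sq_nonneg (paddedCoord d j z - paddedCoord d (j + 2) z)]
  rw [EuclideanSpace.real_norm_sq_eq]
  refine (Finset.sum_le_sum fun j _ => hcoord j).trans ?_
  rw [← Finset.sum_range fun k => 3 * (9 * paddedCoord d (k + 1) z ^ 2 + paddedCoord d k z ^ 2 +
    paddedCoord d (k + 2) z ^ 2), ← Finset.mul_sum, Finset.sum_add_distrib, Finset.sum_add_distrib,
    ← Finset.mul_sum, sum_range_paddedCoord_succ_sq]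
  nlinarith [sum_range_paddedCoord_sq_le z, sum_range_paddedCoord_add_two_sq_le z, sq_nonneg ‖z‖]

theorem chainFunction_zero : chainFunction d 0 = 0 := by
  simp [chainFunction, chainPotential_zero, chainCoord_succ]

/-- Each product is at most half the sum of the two squares, so a coordinate is charged at most its
own square, which its potential covers up to 3. -/
theorem neg_four_mul_le_chainFunction (hd : 1 ≤ d) (x : EuclideanSpace ℝ (Fin d)) :
    -(4 * (d : ℝ)) ≤ chainFunction d x := by
  -- The last coordinate has been charged only half its square, and the pinned value 1 costs 1/2. In
  -- the end 3d + 1/2 ≤ 4d.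
  have key : ∀ m : ℕ, -(3 * (m : ℝ)) + (chainCoord d m x ^ 2 - 1) / 2 ≤
      ∑ k ∈ Finset.range m, (chainPotential (paddedCoord d (k + 1) x) -
        chainCoord d k x * chainCoord d (k + 1) x) := by
    intro m
    induction m with
    | zero => simp [chainCoord_zero]
    | succ m ih =>
      rw [Finset.sum_range_succ, ← chainCoord_succ]
      have h := sq_sub_three_le_chainPotential (chainCoord d (m + 1) x)
      push_cast
      nlinarith [sq_nonneg (chainCoord d m x - chainCoord d (m + 1) x)]
  have h := key d
  have hd' : (1 : ℝ) ≤ d := by exact_mod_cast hd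
  unfold chainFunction
  nlinarith [sq_nonneg (chainCoord d d x)]

theorem coordSupport_chainGradient_subset {m : ℕ} {x : EuclideanSpace ℝ (Fin d)}
    (hx : coordSupport x ⊆ {j | (j : ℕ) < m}) :
    coordSupport (chainGradient d x) ⊆ {j | (j : ℕ) < m + 1} := by
  intro j hj
  by_contra hlt
  have hmj : m + 1 ≤ j := not_lt.mp hlt
  have hzero : ∀ k, m ≤ k → paddedCoord d (k + 1) x = 0 := by
    intro k hk
    rcases lt_or_ge k d with hkd | hkd
    · rw [paddedCoord_succ_of_lt hkd]
      by_contra hne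
      exact absurd (hx (a := ⟨k, hkd⟩) hne) (not_lt.mpr hk)
    · rw [paddedCoord_succ_of_le hkd]
      rfl
  apply hj
  -- The predecessor of j is a genuine coordinate, not the pinned value 1, which acts on coordinate
  -- 0 only.
  obtain ⟨i, hi⟩ : ∃ i, (j : ℕ) = i + 1 := ⟨j - 1, by omega⟩
  rw [chainGradient_apply, ← paddedCoord_succ_val, hzero j (by omega), chainForce_zero,
    chainCoord_succ, hzero (j + 1) (by omega), hi, chainCoord_succ, hzero i (by omega)]
  norm_num

/-- A small gradient prevents any coordinate from being very negative; then the pinned value 1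
propagates along the whole chain, leaving no zero. -/
theorem one_fourth_le_norm_chainGradient {x : EuclideanSpace ℝ (Fin d)} (j₀ : Fin d)
    (hx : x j₀ = 0) : 1 / 4 ≤ ‖chainGradient d x‖ := by
  by_contra! hlt
  have hgrad : ∀ j, -(1 / 4) < chainGradient d x j := fun j =>
    (abs_lt.mp (((Real.norm_eq_abs _).symm.le.trans (PiLp.norm_apply_le _ j)).trans_lt hlt)).1
  obtain ⟨i, -, hi⟩ := Finset.exists_min_image Finset.univ (fun j => x j) ⟨j₀, Finset.mem_univ j₀⟩
  have hi₀ : x i ≤ 0 := hx ▸ hi j₀ (Finset.mem_univ j₀)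
  have hmin : ∀ k, x i ≤ chainCoord d k x := by
    intro k
    cases k with
    | zero => linarith [chainCoord_zero x]
    | succ k =>
      rw [chainCoord_succ]
      rcases lt_or_ge k d with hkd | hkd
      · rw [paddedCoord_succ_of_lt hkd]
        exact hi _ (Finset.mem_univ _)
      · rw [paddedCoord_succ_of_le hkd]
        exact hi₀
  -- At the minimal coordinate the force 3 `x i` outweighs two neighbours of value at least `x i`,
  -- so the gradient entry is at most `x i`.
  have hlow : -(1 / 4) < x i := by
    have h := hgrad i
    rw [chainGradient_apply, chainForce_of_nonpos hi₀] at h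
    linarith [hmin i, hmin (i + 2)]
  -- If the predecessor is at least 1 and the coordinate is below 1, the gradient entry is at most 0
  -- - 1 + 1/4, which is too negative.
  have hone : ∀ k ≤ d, 1 ≤ chainCoord d k x := by
    intro k
    induction k with
    | zero => exact fun _ => (chainCoord_zero x).ge
    | succ k ih =>
      intro hk
      have hprev := ih (by omega)
      rw [chainCoord_succ, paddedCoord_succ_of_lt hk]
      by_contra! hxk
      have h := hgrad ⟨k, hk⟩
      rw [chainGradient_apply] at h
      linarith [chainForce_nonpos_of_le_one hxk.le, hmin (k + 2)]
  have h := hone (j₀ + 1) j₀.2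
  rw [chainCoord_succ, paddedCoord_succ_val, hx] at h
  linarith

end Chain

/-! ### Supports of runs, and the rescaled chain -/

theorem HasGradientAt.const_mul_comp_smul {E : Type*} [NormedAddCommGroup E]
    [InnerProductSpace ℝ E] [CompleteSpace E] {F : E → ℝ} {G x : E} (a b : ℝ)
    (h : HasGradientAt F G (b • x)) :
    HasGradientAt (fun y => a * F (b • y)) ((a * b) • G) x := by
  rw [hasGradientAt_iff_hasFDerivAt] at h ⊢
  refine ((h.comp x ((hasFDerivAt_id x).const_smul b)).const_mul a).congr_fderiv ?_
  ext v
  simp [mul_assoc]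

theorem coordSupport_smul_subset {d : ℕ} (a : ℝ) (v : EuclideanSpace ℝ (Fin d)) :
    coordSupport (a • v) ⊆ coordSupport v := by
  intro j hj hv
  exact hj (by simp [hv])

theorem finiteSum_const {n d : ℕ} [NeZero n] (g : EuclideanSpace ℝ (Fin d) → ℝ) :
    finiteSum (fun _ : Fin n => g) = g := by
  funext x
  have hn : (n : ℝ) ≠ 0 := Nat.cast_ne_zero.mpr (NeZero.ne n)
  simp [finiteSum, hn]

/-- If every oracle call extends the support by at most the next coordinate, then the output of a
run with `T` calls is supported on the first `T` coordinates. -/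
theorem ShuffledFirstOrderRun.coordSupport_output_subset {n d : ℕ} [NeZero n]
    {f : Fin n → EuclideanSpace ℝ (Fin d) → ℝ} {T : ℕ} {Ω : Type*} [MeasurableSpace Ω]
    (A : ShuffledFirstOrderRun f T Ω)
    (hf : ∀ i x m, coordSupport x ⊆ {j | (j : ℕ) < m} →
      coordSupport (gradient (f i) x) ⊆ {j | (j : ℕ) < m + 1}) (ω : Ω) :
    coordSupport (A.output ω) ⊆ {j | (j : ℕ) < T} := by
  have hquery : ∀ k < T, coordSupport (A.query ω k) ⊆ {j | (j : ℕ) < k} := by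
    intro k
    induction k using Nat.strong_induction_on with
    | _ k ih =>
      intro hk
      refine (A.query_support ω k hk).trans (Set.iUnion₂_subset fun l hl => ?_)
      exact (hf _ _ l (ih l hl (hl.trans hk))).trans
        fun j (hj : (j : ℕ) < l + 1) => show (j : ℕ) < k by omega
  refine (A.output_support ω).trans (Set.iUnion₂_subset fun l hl => ?_)
  exact (hf _ _ l (hquery l hl)).trans
    fun j (hj : (j : ℕ) < l + 1) => show (j : ℕ) < T by omega

/-- A run whose output always has a gradient of squared norm above `ε²` does not reach accuracy
`ε`. -/
theorem ShuffledFirstOrderRun.not_reachesAccuracy {n d : ℕ} [NeZero n]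
    {f : Fin n → EuclideanSpace ℝ (Fin d) → ℝ} {T : ℕ} {Ω : Type*} [MeasurableSpace Ω]
    (A : ShuffledFirstOrderRun f T Ω) (P : MeasureTheory.Measure Ω)
    [MeasureTheory.IsProbabilityMeasure P] {ε δ : ℝ} (hδ : 0 < δ) (hlt : ε ^ 2 < δ)
    (h : ∀ ω, δ ≤ ‖gradient (finiteSum f) (A.output ω)‖ ^ 2) : ¬ A.ReachesAccuracy P ε := by
  intro hA
  have hle : ENNReal.ofReal δ ≤
      ∫⁻ ω, ENNReal.ofReal (‖gradient (finiteSum f) (A.output ω)‖ ^ 2) ∂P := by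
    calc ENNReal.ofReal δ = ∫⁻ _, ENNReal.ofReal δ ∂P := by simp
      _ ≤ _ := MeasureTheory.lintegral_mono fun ω => ENNReal.ofReal_le_ofReal (h ω)
  exact absurd (hle.trans hA) (not_le.mpr ((ENNReal.ofReal_lt_ofReal_iff hδ).mpr hlt))

theorem bddBelow_range_chainFunction {d : ℕ} (hd : 1 ≤ d) :
    BddBelow (Set.range (chainFunction d)) :=
  ⟨-(4 * (d : ℝ)), Set.forall_mem_range.mpr (neg_four_mul_le_chainFunction hd)⟩

/-- Otherwise the origin would be a minimizer, although its gradient is nonzero. Strictness allows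
rescaling to any gap Δ. -/
theorem iInf_chainFunction_neg {d : ℕ} (hd : 1 ≤ d) : ⨅ x, chainFunction d x < 0 := by
  by_contra! hinf
  have hmin : IsLocalMin (chainFunction d) 0 := Filter.Eventually.of_forall fun x => by
    rw [chainFunction_zero]
    exact hinf.trans (ciInf_le (bddBelow_range_chainFunction hd) x)
  have hzero : chainGradient d 0 = 0 := by
    have h := hmin.hasFDerivAt_eq_zero (hasGradientAt_chainFunction 0).hasFDerivAt
    simpa using h
  have h := one_fourth_le_norm_chainGradient (x := (0 : EuclideanSpace ℝ (Fin d))) ⟨0, hd⟩ rfl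
  rw [hzero, norm_zero] at h
  linarith

/-- A rescaled chain in dimension `d` is `L`-smooth with initial gap `Δ`, lets each gradient reveal
at most the next coordinate, and has squared gradient norm at least `L Δ / (384 d)` as long as some
coordinate vanishes. -/
theorem exists_scaled_chain {L Δ : ℝ} (hL : 0 < L) (hΔ : 0 < Δ) {d : ℕ} (hd : 1 ≤ d) :
    ∃ g : EuclideanSpace ℝ (Fin d) → ℝ, IsLSmooth L g ∧ BddBelow (Set.range g) ∧
      g 0 - (⨅ x, g x) = Δ ∧
      (∀ x m, coordSupport x ⊆ {j | (j : ℕ) < m} →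
        coordSupport (gradient g x) ⊆ {j | (j : ℕ) < m + 1}) ∧
      ∀ x j, x j = 0 → L * Δ / (384 * d) ≤ ‖gradient g x‖ ^ 2 := by
  have hd' : (0 : ℝ) < d := by exact_mod_cast hd
  set D : ℝ := -⨅ x, chainFunction d x with hDdef
  have hD : 0 < D := neg_pos.mpr (iInf_chainFunction_neg hd)
  have hD4 : D ≤ 4 * d := by
    have h := le_ciInf (neg_four_mul_le_chainFunction hd)
    linarith
  set a : ℝ := Δ / D with ha_def
  have ha : 0 < a := div_pos hΔ hD
  have haD : a * D = Δ := div_mul_cancel₀ Δ hD.ne'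
  set b : ℝ := Real.sqrt (L / (6 * a)) with hb_def
  have hb : 0 < b := Real.sqrt_pos.mpr (by positivity)
  have hb2 : a * b * b * 6 = L := by
    rw [mul_assoc a, ← sq, hb_def, Real.sq_sqrt (by positivity)]
    field_simp
  have hgradAt : ∀ x, HasGradientAt (fun y => a * chainFunction d (b • y))
      ((a * b) • chainGradient d (b • x)) x := fun x =>
    (hasGradientAt_chainFunction (b • x)).const_mul_comp_smul a b
  have hgrad := fun x => (hgradAt x).gradient
  have hinf : ⨅ x, a * chainFunction d (b • x) = a * ⨅ x, chainFunction d x := by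
    rw [Real.mul_iInf_of_nonneg ha.le]
    exact (MulAction.surjective₀ hb.ne').iInf_comp fun x => a * chainFunction d x
  refine ⟨fun y => a * chainFunction d (b • y), ⟨fun x => (hgradAt x).differentiableAt, ?_⟩,
    ?_, ?_, ?_, ?_⟩
  · intro x y
    rw [hgrad, hgrad, ← smul_sub, norm_smul, Real.norm_of_nonneg (by positivity)]
    have h := norm_chainGradient_sub_le (b • x) (b • y)
    rw [← smul_sub, norm_smul, Real.norm_of_nonneg hb.le] at h
    calc a * b * ‖chainGradient d (b • x) - chainGradient d (b • y)‖
        ≤ a * b * (6 * (b * ‖x - y‖)) := by gcongr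
      _ = a * b * b * 6 * ‖x - y‖ := by ring
      _ = L * ‖x - y‖ := by rw [hb2]
  · refine ⟨a * -(4 * (d : ℝ)), Set.forall_mem_range.mpr fun x => ?_⟩
    exact mul_le_mul_of_nonneg_left (neg_four_mul_le_chainFunction hd _) ha.le
  · rw [hinf, ← haD, hDdef]
    simp only [smul_zero, chainFunction_zero]
    ring
  · intro x m hx
    rw [hgrad]
    exact (coordSupport_smul_subset _ _).trans
      (coordSupport_chainGradient_subset ((coordSupport_smul_subset _ _).trans hx))
  · intro x j hxj
    have h : 1 / 4 ≤ ‖chainGradient d (b • x)‖ :=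
      one_fourth_le_norm_chainGradient j (by simp [hxj])
    -- Here (ab)² = aL/6 and a = Δ/D with D ≤ 4d, whence 384 = 6 · 16 · 4.
    have hLa : L * Δ / (384 * d) ≤ (a * b) ^ 2 * (1 / 4) ^ 2 := by
      rw [div_le_iff₀ (by positivity)]
      have : (a * b) ^ 2 * (1 / 4) ^ 2 * (384 * d) = L * a * (4 * d) := by
        rw [← hb2]
        ring
      rw [this, ← haD, mul_assoc]
      gcongr
    rw [hgrad, norm_smul, Real.norm_of_nonneg (by positivity), mul_pow]
    exact hLa.trans (by gcongr)

/-! ### Choice of the dimension -/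

theorem theorem5 :
    ∃ c₀ c : ℝ, 0 < c₀ ∧ 0 < c ∧
      ∀ (L Δ ε : ℝ) (n : ℕ) [NeZero n], 0 < L → 0 < Δ → 0 < ε → ε ^ 2 ≤ c₀ * (L * Δ) →
        ∃ (d : ℕ) (f : Fin n → EuclideanSpace ℝ (Fin d) → ℝ),
          (∀ i, IsLSmooth L (f i)) ∧
          BddBelow (Set.range (finiteSum f)) ∧
          finiteSum f 0 - (⨅ x, finiteSum f x) = Δ ∧
          ∀ (T : ℕ) (Ω : Type*) [MeasurableSpace Ω] (P : MeasureTheory.Measure Ω)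
            [MeasureTheory.IsProbabilityMeasure P] (A : ShuffledFirstOrderRun f T Ω),
            A.ReachesAccuracy P ε → c * (L * Δ / ε ^ 2) ≤ (T : ℝ) := by
  -- 768 = 2 · 384 makes the gradient bound at least 2ε²; the further factor 2 in 1536 absorbs the
  -- floor, since r < d + 1 ≤ 2d.
  refine ⟨1 / 768, 1 / 1536, by norm_num, by norm_num, ?_⟩
  intro L Δ ε n _ hL hΔ hε hεc
  set r : ℝ := L * Δ / (768 * ε ^ 2) with hr
  have hr1 : 1 ≤ r := by
    rw [hr, le_div_iff₀ (by positivity)]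
    linarith
  have hd : 1 ≤ ⌊r⌋₊ := Nat.le_floor (by exact_mod_cast hr1)
  have hfloor : (⌊r⌋₊ : ℝ) ≤ r := Nat.floor_le (by linarith)
  have hfloor' : r < ⌊r⌋₊ + 1 := Nat.lt_floor_add_one r
  generalize ⌊r⌋₊ = d at hd hfloor hfloor'
  have hd' : (1 : ℝ) ≤ d := by exact_mod_cast hd
  obtain ⟨g, hsmooth, hbdd, hgap, hchain, hlarge⟩ := exists_scaled_chain hL hΔ hd
  refine ⟨d, fun _ => g, fun _ => hsmooth, ?_, ?_, ?_⟩
  · rwa [finiteSum_const]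
  · rwa [finiteSum_const]
  intro T Ω _ P _ A hA
  have hrc : 1 / 1536 * (L * Δ / ε ^ 2) = r / 2 := by
    rw [hr]
    field_simp
    norm_num
  rw [hrc]
  by_contra! hT
  have hTd : T < d := by
    have : (T : ℝ) < d := by linarith
    exact_mod_cast this
  have hεlt : ε ^ 2 < L * Δ / (384 * d) := by
    rw [hr, le_div_iff₀ (by positivity)] at hfloor
    rw [lt_div_iff₀ (by positivity)]
    nlinarith [mul_pos hL hΔ]
  refine A.not_reachesAccuracy P (by positivity) hεlt (fun ω => ?_) hA
  rw [finiteSum_const]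
  -- With indices from 0, coordinate T is the first one that T calls cannot reach.
  refine hlarge _ ⟨T, hTd⟩ ?_
  by_contra hne
  exact lt_irrefl T (A.coordSupport_output_subset (fun _ => hchain) ω hne)
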